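/- **Notation and definitions.** A cone in $\mathbb R^2$ is a set $\{\mathbf u : |\mathbf u\cdot\mathbf v|\ge \ell\|\mathbf u\|\}$ with $\mathbf v$ a unit vector (its axis is $\mathbb R\mathbf v$) and $\ell\in(0,1)$; $\|\cdot\|$ is the Euclidean norm. A pair of cones $K^u,K^s$ is *universal* if the axis of $K^u$ is the $x$-axis, the axis of $K^s$ is the $y$-axis, and $K^u\cap K^s=\{\mathbf 0\}$. A cone field on $\mathbb R^2$ assigns to each point $P$ a cone whose unit axis vector $\mathbf v(P)$ and coefficient $\ell(P)$ depend continuously on $P$. Two $C^1$ diffeomorphisms $F_1,F_2:\mathbb R^2\to\mathbb R^2$ are *synchronously hyperbolic* with *divider* $\Gamma$ if they are both orientation reversing or both orientation preserving, and there are $\lambda>1$, a universal pair of cones $K^u,K^s$, and cone fields $(K^u_P)_{P}$, $(K^s_P)_{P}$ such that for all $P\in\mathbb R^2$ and $i=1,2$: * (S1) $K^u_P\subset K^u$, $K^s_P\subset K^s$, $DF_i(P)(K^u_P)\subset K^u_{F_i(P)}$ and $DF_i^{-1}(P)(K^s_P)\subset K^s_{F_i^{-1}(P)}$; * (S2) $\|DF_i(P)\mathbf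 u\|\ge\lambda\|\mathbf u\|$ for $\mathbf u\in K^u_P$, and $\|DF_i^{-1}(P)\mathbf w\|\ge\lambda\|\mathbf w\|$ for $\mathbf w\in K^s_P$; * (S3) $\Gamma\subset\mathbb R^2$ is a $C^1$ curve (regularly parametrized) with $F_1=F_2$ on $\Gamma$, whose tangent vector at each $Q\in\Gamma$ lies in $K^s_Q$, such that the tangent vector to $F_i(\Gamma)$ at $F_i(Q)$ lies in $K^u_{F_i(Q)}$, and which is infinite in both directions, i.e. it is the graph of a function $x=g(y)$ defined for all $y\in\mathbb R$. The closed left (right) half-plane is the set of points lying on $\Gamma$ or to the left (right) of it. Let $F(P)=F_1(P)$ for $P$ in the left half-plane and $F(P)=F_2(P)$ for $P$ in the right half-plane. The map $F$, which is a bijection of $\mathbb R^2$, is called *Lozi-like* if * (L1) $-1<\det DF_i(P)<0$ for all $P\in\mathbb R^2$ and $i=1,2$; * (L2) there is a trapping region $\Delta$ for $F$ (that is, $\Delta\neq\emptyset$ and $F(\overline\Delta)\subset\operatorname{int}\Delta$) that is homeomorphic to an open disk and whose closure is homeomorphic to a closed disk. Put $\Lambda=\bigcap_{n\ge0}F^n(\Delta)$.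 A sequence $\bar p=(p_n)_{n\in\mathbb Z}\in\{-,+\}^{\mathbb Z}$ is an *itinerary* of a point $P$ if, for every $n\in\mathbb Z$, $F^n(P)$ lies in the closed left half-plane when $p_n=-$ and in the closed right half-plane when $p_n=+$ (points whose orbits meet $\Gamma$ may have several itineraries). The sequence $\bar p$ is *admissible* if it is an itinerary of some point of $\Lambda$. **Lemma.** Let $F$ be a Lozi-like map given by synchronously hyperbolic $C^1$ diffeomorphisms $F_1,F_2$ with divider $\Gamma$, let $\Delta$ be a trapping region as in (L2), and let $\Lambda=\bigcap_{n\ge0}F^n(\Delta)$. Then for every admissible sequence $\bar p$ there is exactly one point $P\in\Lambda$ such that $\bar p$ is an itinerary of $P$. -/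

import Mathlib

namespace LoziLike

/-- The Euclidean plane. -/
abbrev Plane : Type := EuclideanSpace ℝ (Fin 2)

/-- The cone with axis spanned by `v` and coefficient `l`; it is used only with `‖v‖ = 1` and
`l ∈ (0, 1)`. -/
def cone (v : Plane) (l : ℝ) : Set Plane :=
  {u | l * ‖u‖ ≤ |inner ℝ u v|}

/-- The closed cone around the `x`-axis with coefficient `l`. -/
def horizontalCone (l : ℝ) : Set Plane := cone !₂[(1 : ℝ), 0] l

/-- The closed cone around the `y`-axis with coefficient `l`. -/
def verticalCone (l : ℝ) : Set Plane := cone !₂[(0 : ℝ), 1] l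

/-- A universal pair of cones: `Ku` is a cone around the `x`-axis, `Ks` is a cone around the
`y`-axis, and they have only the zero vector in common. -/
def IsUniversalPair (Ku Ks : Set Plane) : Prop :=
  (∃ l ∈ Set.Ioo (0 : ℝ) 1, Ku = horizontalCone l) ∧
  (∃ l ∈ Set.Ioo (0 : ℝ) 1, Ks = verticalCone l) ∧
  Ku ∩ Ks = {0}

/-- A cone field on the plane: the unit axis vector and the coefficient depend continuously on the
point. -/
structure ConeField where
  axis : Plane → Plane
  coeff : Plane → ℝ
  norm_axis : ∀ P, ‖axis P‖ = 1
  coeff_mem : ∀ P, coeff P ∈ Set.Ioo (0 : ℝ) 1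
  continuous_axis : Continuous axis
  continuous_coeff : Continuous coeff

/-- The cone that a cone field assigns to the point `P`. -/
def ConeField.at (C : ConeField) (P : Plane) : Set Plane := cone (C.axis P) (C.coeff P)

/-- A bijection of the plane that is a `C¹` diffeomorphism. -/
def IsC1Diffeo (f : Plane ≃ Plane) : Prop :=
  ContDiff ℝ 1 f ∧ ContDiff ℝ 1 f.symm

/-- The diffeomorphism `f` preserves the orientation of the plane. -/
def OrientationPreserving (f : Plane ≃ Plane) : Prop :=
  ∀ P, 0 < (fderiv ℝ f P).det

/-- The diffeomorphism `f` reverses the orientation of the plane. -/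
def OrientationReversing (f : Plane ≃ Plane) : Prop :=
  ∀ P, (fderiv ℝ f P).det < 0

/-- Invariance of the cone fields `Cu`, `Cs` under `f` and `f⁻¹`, respectively, and expansion by the
factor `lam` of the vectors in these cones. -/
structure RespectsConeFields (f : Plane ≃ Plane) (lam : ℝ) (Cu Cs : ConeField) : Prop where
  maps_unstable : ∀ P, ∀ u ∈ Cu.at P, fderiv ℝ f P u ∈ Cu.at (f P)
  maps_stable : ∀ P, ∀ w ∈ Cs.at P, fderiv ℝ f.symm P w ∈ Cs.at (f.symm P)
  expands_unstable : ∀ P, ∀ u ∈ Cu.at P, lam * ‖u‖ ≤ ‖fderiv ℝ f P u‖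
  expands_stable : ∀ P, ∀ w ∈ Cs.at P, lam * ‖w‖ ≤ ‖fderiv ℝ f.symm P w‖

/-- `G` is a divider for `F₁`, `F₂`: a smooth curve with a regular parametrization `γ`, whose
tangent vectors lie in the stable cones, whose images under `F₁` and `F₂` coincide pointwise and have
tangent vectors in the unstable cones, and which is infinite in both directions (every real number
is the second coordinate of one of its points). -/
def IsDivider (F₁ F₂ : Plane ≃ Plane) (Cu Cs : ConeField) (G : Set Plane) : Prop :=
  ∃ γ : ℝ → Plane, ContDiff ℝ 1 γ ∧ (∀ t, deriv γ t ≠ 0) ∧ Set.range γ = G ∧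
    (∀ t, F₁ (γ t) = F₂ (γ t)) ∧
    (∀ t, deriv γ t ∈ Cs.at (γ t)) ∧
    (∀ t, deriv (fun s => F₁ (γ s)) t ∈ Cu.at (F₁ (γ t))) ∧
    (∀ t, deriv (fun s => F₂ (γ s)) t ∈ Cu.at (F₂ (γ t))) ∧
    (∀ y : ℝ, ∃ t, γ t 1 = y)

/-- `F₁` and `F₂` are synchronously hyperbolic `C¹` diffeomorphisms with the divider `G`. -/
def SynchronouslyHyperbolic (F₁ F₂ : Plane ≃ Plane) (G : Set Plane) : Prop :=
  IsC1Diffeo F₁ ∧ IsC1Diffeo F₂ ∧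
  ((OrientationReversing F₁ ∧ OrientationReversing F₂) ∨
    (OrientationPreserving F₁ ∧ OrientationPreserving F₂)) ∧
  ∃ (lam : ℝ) (Ku Ks : Set Plane) (Cu Cs : ConeField),
    1 < lam ∧ IsUniversalPair Ku Ks ∧
    (∀ P, Cu.at P ⊆ Ku) ∧ (∀ P, Cs.at P ⊆ Ks) ∧
    RespectsConeFields F₁ lam Cu Cs ∧ RespectsConeFields F₂ lam Cu Cs ∧
    IsDivider F₁ F₂ Cu Cs G

/-- The closed left half-plane of `G`: the points on `G` or to the left of `G`. A divider has exactly
one point at each height. -/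
def leftHalfPlane (G : Set Plane) : Set Plane :=
  {P | ∃ Q ∈ G, Q 1 = P 1 ∧ P 0 ≤ Q 0}

/-- The closed right half-plane of `G`: the points on `G` or to the right of `G`. -/
def rightHalfPlane (G : Set Plane) : Set Plane :=
  {P | ∃ Q ∈ G, Q 1 = P 1 ∧ Q 0 ≤ P 0}

open Classical in
/-- The map equal to `F₁` on the left half-plane and to `F₂` on the right half-plane (the two agree
on the divider, so it does not matter which formula is used there). -/
noncomputable def glue (F₁ F₂ : Plane ≃ Plane) (G : Set Plane) (P : Plane) : Plane :=
  if P ∈ leftHalfPlane G then F₁ P else F₂ P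

/-- A trapping region: a nonempty set that is mapped with its closure into its interior. -/
def IsTrappingRegion (F : Plane → Plane) (D : Set Plane) : Prop :=
  D.Nonempty ∧ F '' closure D ⊆ interior D

/-- The map `glue F₁ F₂ G` is Lozi-like, with the trapping region `D`. -/
structure IsLoziLike (F₁ F₂ : Plane ≃ Plane) (G D : Set Plane) : Prop where
  synchronouslyHyperbolic : SynchronouslyHyperbolic F₁ F₂ G
  det_left : ∀ P, -1 < (fderiv ℝ F₁ P).det ∧ (fderiv ℝ F₁ P).det < 0
  det_right : ∀ P, -1 < (fderiv ℝ F₂ P).det ∧ (fderiv ℝ F₂ P).det < 0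
  trapping : IsTrappingRegion (glue F₁ F₂ G) D
  homeo_disk : Nonempty (D ≃ₜ Metric.ball (0 : Plane) 1)
  closure_homeo_disk : Nonempty (closure D ≃ₜ Metric.closedBall (0 : Plane) 1)

/-- The set `⋂ Fⁿ(D)`, `n ≥ 0`. -/
def attractor (F : Plane → Plane) (D : Set Plane) : Set Plane :=
  ⋂ n : ℕ, F^[n] '' D

/-- The two symbols of the coding. -/
inductive Sgn where
  | minus : Sgn
  | plus : Sgn

/-- The closed half-plane coded by a symbol. -/
def halfPlane (G : Set Plane) : Sgn → Set Plane
  | Sgn.minus => leftHalfPlane G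
  | Sgn.plus => rightHalfPlane G

/-- `p` is an itinerary of `P`: the `n`-th point `x n` of the bi-infinite orbit of `P` under `F` lies
in the half-plane coded by `p n`, for every integer `n`. (For a Lozi-like map `F`, which is a
bijection, `x n` is `Fⁿ(P)`.) -/
def IsItinerary (F : Plane → Plane) (G : Set Plane) (P : Plane) (p : ℤ → Sgn) : Prop :=
  ∃ x : ℤ → Plane, x 0 = P ∧ (∀ n, x (n + 1) = F (x n)) ∧ ∀ n, x n ∈ halfPlane G (p n)

/-- `p` is admissible: it is an itinerary of some point of the attractor. -/
def IsAdmissible (F : Plane → Plane) (G D : Set Plane) (p : ℤ → Sgn) : Prop :=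
  ∃ Q ∈ attractor F D, IsItinerary F G Q p

end LoziLike

/-!
The existence of the point is the definition of admissibility; the content is uniqueness.

Let `x` and `y` be two orbits in the attractor with the same itinerary. Since each of the two
diffeomorphisms respects the cone fields on the whole plane, the itinerary turns both orbits into
orbits of one sequence of globally defined diffeomorphisms, and the two half-planes play no further
part. As the orbits lie in a trapping region with compact closure, they stay at a bounded distance
for all times, positive and negative.

Suppose that `f`, an `n`-fold composition of maps of the sequence, expands unstable cones by
`μ = λⁿ`. Take a curve `U` through `x 0` tangent to the unstable cones and a curve `S` through `y n`
tangent to the stable cones (`ConeField.exists_tangent_curve`). Then `f⁻¹(S)` passes through `y 0`,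
and because the cone fields lie in a universal pair of cones, whose bounding slopes have product less
than `1`, it meets `U` in a point `z` (`exists_crossing`). The distance from `z` to `x 0` is of order
`1 / μ`, since `f` expands it along `U` to a length that stays bounded, while `z - y 0` lies in the
universal stable cone (`exists_near_point`). Letting `n` tend to infinity, `x 0 - y 0` lies in
the closed universal stable cone (`sub_mem_slopeCone_of_bounded_orbits`). The same argument for
the inverse maps puts `x 0 - y 0` into the universal unstable cone, so it is zero.

All comparisons of lengths along curves are instances of Cauchy's mean value theorem
(`abs_sub_le_of_abs_deriv_le`).

That the backward orbit of a point of the attractor remains in the trapping region requires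
the glued map to be injective (`glue_injective`): `F₂⁻¹ ∘ F₁` fixes the divider and preserves the
orientation, hence maps each side of the divider into itself (`left_of_graph_of_fixes`).
-/

namespace LoziLike

open Set Filter Topology

/-! ### Cones described by slopes -/

/-- The vectors of the plane whose slope with respect to the `i`-th axis is at most `M`; here `j` is
meant to be the other index. Taking both indices as arguments lets the same statements serve for
the horizontal and the vertical direction. -/
def slopeCone (i j : Fin 2) (M : ℝ) : Set Plane := {u | |u j| ≤ M * |u i|}

theorem norm_le_abs_add_abs {i j : Fin 2} (hij : i ≠ j) (u : Plane) : ‖u‖ ≤ |u i| + |u j| := by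
  have h : ‖u‖ ^ 2 = u i ^ 2 + u j ^ 2 := by
    rw [EuclideanSpace.real_norm_sq_eq, Fin.sum_univ_two]
    fin_cases i <;> fin_cases j <;> simp_all [add_comm]
  refine abs_le_of_sq_le_sq' ?_ (by positivity) |>.2
  rw [h]
  nlinarith [abs_nonneg (u i), abs_nonneg (u j), sq_abs (u i), sq_abs (u j),
    mul_nonneg (abs_nonneg (u i)) (abs_nonneg (u j))]

theorem abs_apply_le_norm (u : Plane) (i : Fin 2) : |u i| ≤ ‖u‖ := by
  simpa using PiLp.norm_apply_le u i

theorem norm_le_of_mem_slopeCone {i j : Fin 2} (hij : i ≠ j) {M : ℝ} {u : Plane}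
    (hu : u ∈ slopeCone i j M) : ‖u‖ ≤ (1 + M) * |u i| := by
  have h1 := norm_le_abs_add_abs hij u
  have h2 : |u j| ≤ M * |u i| := hu
  linarith

theorem apply_ne_zero_of_mem_slopeCone {i j : Fin 2} (hij : i ≠ j) {M : ℝ} {u : Plane}
    (hu : u ∈ slopeCone i j M) (h0 : u ≠ 0) : u i ≠ 0 := by
  intro h
  have := norm_le_of_mem_slopeCone hij hu
  rw [h, abs_zero, mul_zero] at this
  exact h0 (norm_le_zero_iff.1 this)

theorem exists_coordCone_eq_slopeCone {i j : Fin 2} (hij : i ≠ j) {l : ℝ} (hl : l ∈ Ioo (0 : ℝ) 1) :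
    ∃ M, 0 ≤ M ∧ {u : Plane | l * ‖u‖ ≤ |u i|} = slopeCone i j M := by
  obtain ⟨h0, h1⟩ := hl
  have hd : 0 ≤ 1 - l ^ 2 := by nlinarith
  refine ⟨√(1 - l ^ 2) / l, by positivity, ?_⟩
  ext u
  have h : ‖u‖ ^ 2 = u i ^ 2 + u j ^ 2 := by
    rw [EuclideanSpace.real_norm_sq_eq, Fin.sum_univ_two]
    fin_cases i <;> fin_cases j <;> simp_all [add_comm]
  simp only [slopeCone, mem_ofPred_eq]
  rw [div_mul_eq_mul_div, le_div_iff₀ h0, ← abs_of_nonneg (by positivity : 0 ≤ l * ‖u‖), ← sq_le_sq,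
    ← abs_of_nonneg (by positivity : 0 ≤ |u j| * l),
    ← abs_of_nonneg (by positivity : 0 ≤ √(1 - l ^ 2) * |u i|), ← sq_le_sq, mul_pow, mul_pow,
    mul_pow, h, Real.sq_sqrt hd, sq_abs, sq_abs]
  constructor <;> intro h <;> nlinarith

theorem exists_horizontalCone_eq {l : ℝ} (hl : l ∈ Ioo (0 : ℝ) 1) :
    ∃ M, 0 ≤ M ∧ horizontalCone l = slopeCone 0 1 M := by
  obtain ⟨M, hM, h⟩ := exists_coordCone_eq_slopeCone (i := 0) (j := 1) (by decide) hl
  refine ⟨M, hM, h ▸ ?_⟩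
  ext u
  simp [horizontalCone, cone, PiLp.inner_apply, Fin.sum_univ_two]

theorem exists_verticalCone_eq {l : ℝ} (hl : l ∈ Ioo (0 : ℝ) 1) :
    ∃ M, 0 ≤ M ∧ verticalCone l = slopeCone 1 0 M := by
  obtain ⟨M, hM, h⟩ := exists_coordCone_eq_slopeCone (i := 1) (j := 0) (by decide) hl
  refine ⟨M, hM, h ▸ ?_⟩
  ext u
  simp [verticalCone, cone, PiLp.inner_apply, Fin.sum_univ_two]

theorem mul_lt_one_of_slopeCone_inter {M N : ℝ} (hM : 0 ≤ M)
    (h : slopeCone 0 1 M ∩ slopeCone 1 0 N = {0}) : M * N < 1 := by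
  by_contra! hc
  have : (!₂[1, M] : Plane) ∈ slopeCone 0 1 M ∩ slopeCone 1 0 N := by
    simp only [slopeCone, mem_inter_iff, mem_ofPred_eq]
    simp [abs_of_nonneg hM]
    linarith
  rw [h] at this
  have := congrArg (fun u : Plane => u 0) (mem_singleton_iff.1 this)
  simp at this

/-! ### Cauchy's mean value theorem along curves -/

/-- The form of Cauchy's mean value theorem used throughout: a bound between two derivatives passes
to increments, and no information on the sign of the derivatives is needed. -/
theorem abs_sub_le_of_abs_deriv_le {φ ψ φ' ψ' : ℝ → ℝ} {I : Set ℝ} (hI : I.OrdConnected) {K : ℝ}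
    (hφ : ∀ t ∈ I, HasDerivAt φ (φ' t) t) (hψ : ∀ t ∈ I, HasDerivAt ψ (ψ' t) t)
    (hne : ∀ t ∈ I, ψ' t ≠ 0) (hK : ∀ t ∈ I, |φ' t| ≤ K * |ψ' t|) {s t : ℝ} (hs : s ∈ I)
    (ht : t ∈ I) : |φ t - φ s| ≤ K * |ψ t - ψ s| := by
  wlog hst : s < t generalizing s t
  · rcases (not_lt.1 hst).lt_or_eq with h | h
    · rw [abs_sub_comm (φ t), abs_sub_comm (ψ t)]
      exact this ht hs h
    · simp [h]
  have hsub : Icc s t ⊆ I := hI.out hs ht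
  obtain ⟨c, hc, h⟩ := exists_ratio_hasDerivAt_eq_ratio_slope φ φ' hst
    (fun x hx => (hφ x (hsub hx)).continuousAt.continuousWithinAt)
    (fun x hx => hφ x (hsub (Ioo_subset_Icc_self hx))) ψ ψ'
    (fun x hx => (hψ x (hsub hx)).continuousAt.continuousWithinAt)
    (fun x hx => hψ x (hsub (Ioo_subset_Icc_self hx)))
  have hcI := hsub (Ioo_subset_Icc_self hc)
  have hpos : 0 < |ψ' c| := abs_pos.2 (hne c hcI)
  have h' : |ψ t - ψ s| * |φ' c| = |φ t - φ s| * |ψ' c| := by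
    rw [← abs_mul, ← abs_mul, h]
  refine le_of_mul_le_mul_right ?_ hpos
  rw [← h']
  nlinarith [mul_le_mul_of_nonneg_left (hK c hcI) (abs_nonneg (ψ t - ψ s))]

theorem hasDerivAt_apply {c : ℝ → Plane} {c' : Plane} {t : ℝ} (h : HasDerivAt c c' t) (k : Fin 2) :
    HasDerivAt (fun s => c s k) (c' k) t :=
  (EuclideanSpace.proj (𝕜 := ℝ) k).hasFDerivAt.comp_hasDerivAt t h

theorem sub_mem_slopeCone {i j : Fin 2} (hij : i ≠ j) {M : ℝ} {c c' : ℝ → Plane} {I : Set ℝ}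
    (hI : I.OrdConnected) (hc : ∀ t ∈ I, HasDerivAt c (c' t) t) (hne : ∀ t ∈ I, c' t ≠ 0)
    (hM : ∀ t ∈ I, c' t ∈ slopeCone i j M) {s t : ℝ} (hs : s ∈ I) (ht : t ∈ I) :
    c t - c s ∈ slopeCone i j M :=
  abs_sub_le_of_abs_deriv_le (φ := fun t => c t j) (ψ := fun t => c t i) hI
    (fun t ht => hasDerivAt_apply (hc t ht) j) (fun t ht => hasDerivAt_apply (hc t ht) i)
    (fun t ht => apply_ne_zero_of_mem_slopeCone hij (hM t ht) (hne t ht)) hM hs ht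

/-! ### Curves tangent to a cone field -/

/-- A cone field inside a coordinate cone has a smooth section normalized to have `i`-th coordinate
`1`. The axis field itself is only continuous; the section is obtained by a smooth partition of
unity, since each cone has interior and one of its two nappes is convex. -/
theorem ConeField.exists_contDiff_section (C : ConeField) {i j : Fin 2} (hij : i ≠ j) {M : ℝ}
    (hC : ∀ P, C.at P ⊆ slopeCone i j M) :
    ∃ w : Plane → Plane, ContDiff ℝ 1 w ∧ ∀ P, w P i = 1 ∧ w P ∈ C.at P := by
  have hne : ∀ P, C.axis P i ≠ 0 := fun P => by
    refine apply_ne_zero_of_mem_slopeCone hij (hC P ?_) (norm_ne_zero_iff.1 (by simp [C.norm_axis]))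
    simp [ConeField.at, cone, C.norm_axis, (C.coeff_mem P).2.le]
  let u : Plane → Plane := fun P => (C.axis P i)⁻¹ • C.axis P
  have hu : Continuous u := by
    have h1 : Continuous fun P => C.axis P i :=
      (EuclideanSpace.proj (𝕜 := ℝ) i).continuous.comp C.continuous_axis
    exact (h1.inv₀ hne).smul C.continuous_axis
  have hui : ∀ P, u P i = 1 := fun P => by simp [u, hne P]
  have hu0 : ∀ P, 0 < ‖u P‖ := fun P => norm_pos_iff.2 fun h => by
    have := hui P
    simp [h] at this
  have hunorm : ∀ P, ‖u P‖ = |C.axis P i|⁻¹ := fun P => by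
    simp [u, norm_smul, C.norm_axis]
  -- the part of the nappe around `u P` at height `1`
  let S : Plane → Set Plane := fun P =>
    {w | w i = 1 ∧ C.coeff P * ‖u P‖ * ‖w‖ ≤ inner ℝ w (u P)}
  have hconv : ∀ P, Convex ℝ (S P) := by
    rintro P x ⟨hx1, hx2⟩ y ⟨hy1, hy2⟩ a b ha hb hab
    refine ⟨by simp [hx1, hy1, hab], ?_⟩
    rw [inner_add_left, real_inner_smul_left, real_inner_smul_left]
    have h1 : ‖a • x + b • y‖ ≤ a * ‖x‖ + b * ‖y‖ := by
      refine (norm_add_le _ _).trans ?_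
      simp [norm_smul, abs_of_nonneg ha, abs_of_nonneg hb]
    have h2 : 0 ≤ C.coeff P * ‖u P‖ := mul_nonneg (C.coeff_mem P).1.le (norm_nonneg _)
    nlinarith [mul_le_mul_of_nonneg_left h1 h2, mul_le_mul_of_nonneg_left hx2 ha,
      mul_le_mul_of_nonneg_left hy2 hb]
  have hloc : ∀ P, ∃ c : Plane, ∀ᶠ Q in 𝓝 P, c ∈ S Q := fun P => by
    refine ⟨u P, ?_⟩
    have hc1 : Continuous fun Q => C.coeff Q * ‖u Q‖ * ‖u P‖ :=
      (C.continuous_coeff.mul hu.norm).mul continuous_const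
    have hc2 : Continuous fun Q => inner ℝ (u P) (u Q) := continuous_const.inner hu
    have hlt : C.coeff P * ‖u P‖ * ‖u P‖ < inner ℝ (u P) (u P) := by
      rw [real_inner_self_eq_norm_mul_norm]
      nlinarith [mul_pos (hu0 P) (hu0 P), (C.coeff_mem P).2]
    filter_upwards [hc1.continuousAt.eventually_lt hc2.continuousAt hlt] with Q hQ
    exact ⟨hui P, hQ.le⟩
  obtain ⟨g, hg⟩ := exists_contMDiffMap_forall_mem_convex_of_local_const (n := 1)
    (modelWithCornersSelf ℝ Plane) hconv hloc
  refine ⟨g, g.contMDiff.contDiff, fun P => ⟨(hg P).1, ?_⟩⟩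
  have h := (hg P).2
  have ha : 0 < |C.axis P i| := abs_pos.2 (hne P)
  change C.coeff P * ‖g P‖ ≤ |inner ℝ (g P) (C.axis P)|
  have h3 : inner ℝ (g P) (u P) ≤ |C.axis P i|⁻¹ * |inner ℝ (g P) (C.axis P)| := by
    rw [show inner ℝ (g P) (u P) = (C.axis P i)⁻¹ * inner ℝ (g P) (C.axis P) from
      real_inner_smul_right _ _ _, ← abs_inv, ← abs_mul]
    exact le_abs_self _
  rw [hunorm] at h
  refine le_of_mul_le_mul_left ?_ (inv_pos.2 ha)
  linarith

/-- Through every point there is a curve tangent to the cone field, parametrized by the `i`-th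
coordinate, of any prescribed extent. The vector field is bounded, so that the Picard–Lindelöf theorem
applies on a ball large enough for the whole time interval. -/
theorem ConeField.exists_tangent_curve (C : ConeField) {i j : Fin 2} (hij : i ≠ j) {M : ℝ}
    (hM : 0 ≤ M) (hC : ∀ P, C.at P ⊆ slopeCone i j M) (x : Plane) {T : ℝ} (hT : 0 ≤ T) :
    ∃ c c' : ℝ → Plane, c 0 = x ∧
      ∀ t ∈ Icc (-T) T, HasDerivAt c (c' t) t ∧ c' t ∈ C.at (c t) ∧ c' t i = 1 := by
  obtain ⟨w, hw, hwC⟩ := C.exists_contDiff_section hij hC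
  have hbound : ∀ P, ‖w P‖ ≤ 1 + M := fun P => by
    have := norm_le_of_mem_slopeCone hij (hC P (hwC P).2)
    simpa [(hwC P).1] using this
  -- one unit of slack on both sides gives two-sided derivatives at the endpoints
  let a : NNReal := ⟨(1 + M) * (T + 1), by positivity⟩
  obtain ⟨K, hK⟩ := hw.contDiffOn.exists_lipschitzOnWith (by simp) (convex_closedBall x a)
    (isCompact_closedBall x a)
  have h0 : (0 : ℝ) ∈ Icc (-(T + 1)) (T + 1) := ⟨by linarith, by linarith⟩
  have hPL : IsPicardLindelof (fun _ => w) (⟨0, h0⟩ : Icc (-(T + 1)) (T + 1)) x a 0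
      ⟨1 + M, by positivity⟩ K :=
    { lipschitzOnWith := fun _ _ => hK
      continuousOn := fun _ _ => continuousOn_const
      norm_le := fun _ _ P _ => hbound P
      mul_max_le := by
        simp only [sub_zero, zero_sub, neg_neg, max_self, NNReal.coe_zero]
        exact le_rfl }
  obtain ⟨c, hc0, hc⟩ := hPL.exists_eq_forall_mem_Icc_hasDerivWithinAt₀
  refine ⟨c, fun t => w (c t), hc0, fun t ht => ⟨?_, (hwC _).2, (hwC _).1⟩⟩
  exact (hc t ⟨by linarith [ht.1], by linarith [ht.2]⟩).hasDerivAt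
    (Icc_mem_nhds (by linarith [ht.1]) (by linarith [ht.2]))

/-! ### The effect of a hyperbolic diffeomorphism on tangent curves -/

theorem RespectsConeFields.inverse {f : Plane ≃ Plane} {lam : ℝ} {A B : ConeField}
    (h : RespectsConeFields f lam A B) : RespectsConeFields f.symm lam B A :=
  ⟨h.maps_stable, h.maps_unstable, h.expands_stable, h.expands_unstable⟩

theorem IsC1Diffeo.inverse {f : Plane ≃ Plane} (h : IsC1Diffeo f) : IsC1Diffeo f.symm :=
  ⟨h.2, h.1⟩

theorem IsC1Diffeo.trans {f g : Plane ≃ Plane} (hf : IsC1Diffeo f) (hg : IsC1Diffeo g) :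
    IsC1Diffeo (f.trans g) :=
  ⟨hg.1.comp hf.1, hf.2.comp hg.2⟩

theorem IsC1Diffeo.differentiable {f : Plane ≃ Plane} (h : IsC1Diffeo f) : Differentiable ℝ f :=
  h.1.differentiable (by simp)

theorem fderiv_trans {f g : Plane ≃ Plane} (hf : IsC1Diffeo f) (hg : IsC1Diffeo g) (P u : Plane) :
    fderiv ℝ (f.trans g) P u = fderiv ℝ g (f P) (fderiv ℝ f P u) := by
  have : fderiv ℝ (g ∘ f) P = (fderiv ℝ g (f P)).comp (fderiv ℝ f P) :=
    fderiv_comp P (hg.differentiable _) (hf.differentiable _)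
  rw [Equiv.coe_trans, this]
  rfl

theorem RespectsConeFields.trans {f g : Plane ≃ Plane} {l m : ℝ} {A B : ConeField}
    (hf1 : IsC1Diffeo f) (hg1 : IsC1Diffeo g) (hl : 0 ≤ l) (hm : 0 ≤ m)
    (hf : RespectsConeFields f l A B) (hg : RespectsConeFields g m A B) :
    RespectsConeFields (f.trans g) (m * l) A B where
  maps_unstable P u hu := by
    rw [fderiv_trans hf1 hg1]
    exact hg.maps_unstable _ _ (hf.maps_unstable _ _ hu)
  maps_stable P u hu := by
    rw [Equiv.symm_trans, fderiv_trans hg1.inverse hf1.inverse]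
    exact hf.maps_stable _ _ (hg.maps_stable _ _ hu)
  expands_unstable P u hu := by
    rw [fderiv_trans hf1 hg1, mul_assoc]
    exact (mul_le_mul_of_nonneg_left (hf.expands_unstable _ _ hu) hm).trans
      (hg.expands_unstable _ _ (hf.maps_unstable _ _ hu))
  expands_stable P u hu := by
    rw [Equiv.symm_trans, fderiv_trans hg1.inverse hf1.inverse, mul_comm m l, mul_assoc]
    exact (mul_le_mul_of_nonneg_left (hg.expands_stable _ _ hu) hl).trans
      (hf.expands_stable _ _ (hg.maps_stable _ _ hu))

/-- A curve tangent to the expanded cones, parametrized by its `i`-th coordinate, is mapped to a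
curve whose chords lie in the coordinate cone and are longer by a definite multiple of the rate
of expansion. -/
theorem RespectsConeFields.image_curve {f : Plane ≃ Plane} {mu : ℝ} {A B : ConeField}
    (hf1 : IsC1Diffeo f) (hf : RespectsConeFields f mu A B) (hmu : 0 < mu) {i j : Fin 2}
    (hij : i ≠ j) {M : ℝ} (hA : ∀ P, A.at P ⊆ slopeCone i j M) {c c' : ℝ → Plane}
    {I : Set ℝ} (hI : I.OrdConnected)
    (hc : ∀ t ∈ I, HasDerivAt c (c' t) t ∧ c' t ∈ A.at (c t) ∧ c' t i = 1)
    {s t : ℝ} (hs : s ∈ I) (ht : t ∈ I) :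
    f (c t) - f (c s) ∈ slopeCone i j M ∧
      mu * |t - s| ≤ (1 + M) * |f (c t) i - f (c s) i| := by
  have hd : ∀ t ∈ I, HasDerivAt (fun t => f (c t)) (fderiv ℝ f (c t) (c' t)) t := fun t ht =>
    (hf1.differentiable (c t)).hasFDerivAt.comp_hasDerivAt t (hc t ht).1
  have hmem : ∀ t ∈ I, fderiv ℝ f (c t) (c' t) ∈ slopeCone i j M := fun t ht =>
    hA _ (hf.maps_unstable _ _ (hc t ht).2.1)
  have hexp : ∀ t ∈ I, mu ≤ (1 + M) * |fderiv ℝ f (c t) (c' t) i| := fun t ht => by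
    have h1 := hf.expands_unstable _ _ (hc t ht).2.1
    have h2 := norm_le_of_mem_slopeCone hij (hmem t ht)
    have h3 : 1 ≤ ‖c' t‖ := by simpa [(hc t ht).2.2] using abs_apply_le_norm (c' t) i
    nlinarith
  have hne : ∀ t ∈ I, fderiv ℝ f (c t) (c' t) i ≠ 0 := fun t ht h => by
    have := hexp t ht
    simp only [h, abs_zero, mul_zero] at this
    linarith
  refine ⟨sub_mem_slopeCone hij hI hd (fun t ht h => hne t ht (by simp [h])) hmem hs ht, ?_⟩
  have := abs_sub_le_of_abs_deriv_le (φ := fun t => t) (φ' := fun _ => 1) (K := (1 + M) / mu)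
    (ψ := fun t => f (c t) i) hI (fun t _ => hasDerivAt_id t)
    (fun t ht => hasDerivAt_apply (hd t ht) i) hne
    (fun t ht => by
      rw [abs_one, div_mul_eq_mul_div, le_div_iff₀ hmu, one_mul]
      exact hexp t ht) hs ht
  rw [div_mul_eq_mul_div, le_div_iff₀ hmu] at this
  linarith

/-! ### Crossing of tangent curves -/

/-- A continuous real function on `[-T, T]` that expands distances by at least `m` takes all values
at distance at most `m * T` from its value at `0`. -/
theorem exists_eq_of_expanding {τ : ℝ → ℝ} {T m : ℝ} (hT : 0 ≤ T) (hm : 0 < m)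
    (hτ : ContinuousOn τ (Icc (-T) T))
    (hexp : ∀ s ∈ Icc (-T) T, ∀ t ∈ Icc (-T) T, m * |t - s| ≤ |τ t - τ s|) {y : ℝ}
    (hy : |y - τ 0| ≤ m * T) : ∃ s ∈ Icc (-T) T, τ s = y := by
  have hl : -T ∈ Icc (-T) T := ⟨le_rfl, by linarith⟩
  have hr : T ∈ Icc (-T) T := ⟨by linarith, le_rfl⟩
  have hz : (0 : ℝ) ∈ Icc (-T) T := ⟨by linarith, hT⟩
  have hinj : InjOn τ (Icc (-T) T) := fun s hs t ht h => by
    have := hexp s hs t ht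
    rw [h, sub_self, abs_zero] at this
    have h0 : |t - s| ≤ 0 := by
      by_contra! hc
      nlinarith
    linarith [abs_nonpos_iff.1 h0]
  have h1 := hexp 0 hz T hr
  have h2 := hexp 0 hz (-T) hl
  rw [sub_zero, abs_of_nonneg hT] at h1
  rw [sub_zero, abs_neg, abs_of_nonneg hT] at h2
  have hlr : -T ≤ T := by linarith
  have hy' := abs_le.1 hy
  rcases hτ.strictMonoOn_of_injOn_Icc' hlr hinj with hmono | hanti
  · have h3 := hmono.monotoneOn hz hr hT
    have h4 := hmono.monotoneOn hl hz (by linarith)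
    rw [abs_of_nonneg (by linarith)] at h1
    rw [abs_of_nonpos (by linarith)] at h2
    exact intermediate_value_Icc hlr hτ ⟨by linarith, by linarith⟩
  · have h3 := hanti.antitoneOn hz hr hT
    have h4 := hanti.antitoneOn hl hz (by linarith)
    rw [abs_of_nonpos (by linarith)] at h1
    rw [abs_of_nonneg (by linarith)] at h2
    exact intermediate_value_Icc' hlr hτ ⟨by linarith, by linarith⟩

/-- A long curve `c` through `x`, parametrized by its `i`-th coordinate, with slopes at most `M`,
meets a long set through `y` whose slopes with respect to the other axis are at most `N`, provided
that `M * N < 1`, which guarantees that all large `T` satisfy `hTR`. The chord condition makes the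
set the graph of a Lipschitz function over the `j`-th axis, so that the crossing is a fixed point of
a continuous map of `[-T, T]`, up to translation, found by the intermediate value theorem. -/
theorem exists_crossing {i j : Fin 2} {M N R T L : ℝ}
    (hN : 0 ≤ N) (hT : 0 ≤ T) (hTR : R + N * (R + M * T) ≤ T) (hL : R + M * T ≤ L)
    {x y : Plane} (hxy : ∀ k, |x k - y k| ≤ R) {c : ℝ → Plane} (hcc : ContinuousOn c (Icc (-T) T))
    (hci : ∀ t ∈ Icc (-T) T, c t i = x i + t)
    (hcj : ∀ t ∈ Icc (-T) T, |c t j - x j| ≤ M * T)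
    {S : Set Plane} (hy : y ∈ S) (hS : ∀ P ∈ S, ∀ Q ∈ S, Q - P ∈ slopeCone j i N)
    (hcov : ∀ r, |r - y j| ≤ L → ∃ Q ∈ S, Q j = r) :
    ∃ t ∈ Icc (-T) T, ∃ Q ∈ S, Q i = c t i ∧ Q j = c t j := by
  have hnear : ∀ t ∈ Icc (-T) T, |c t j - y j| ≤ R + M * T := fun t ht => by
    have h1 := abs_sub_le (c t j) (x j) (y j)
    linarith [hcj t ht, hxy j]
  have hex : ∀ t : ℝ, ∃ Q, t ∈ Icc (-T) T → Q ∈ S ∧ Q j = c t j := fun t => by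
    by_cases ht : t ∈ Icc (-T) T
    · obtain ⟨Q, hQ, h⟩ := hcov (c t j) ((hnear t ht).trans hL)
      exact ⟨Q, fun _ => ⟨hQ, h⟩⟩
    · exact ⟨0, fun h => absurd h ht⟩
  choose q hq using hex
  have hchord : ∀ P ∈ S, ∀ Q ∈ S, |Q i - P i| ≤ N * |Q j - P j| := fun P hP Q hQ => hS P hP Q hQ
  have hcont : ContinuousOn (fun t => q t i) (Icc (-T) T) := by
    have hcj' : ContinuousOn (fun t => c t j) (Icc (-T) T) :=
      (EuclideanSpace.proj (𝕜 := ℝ) j).continuous.comp_continuousOn hcc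
    intro t ht
    have h1 : Tendsto (fun s => N * |c s j - c t j|) (𝓝[Icc (-T) T] t) (𝓝 0) := by
      have := ((hcj' t ht).tendsto.sub_const (c t j)).abs.const_mul N
      simpa using this
    refine tendsto_iff_dist_tendsto_zero.2 (squeeze_zero' (Eventually.of_forall fun _ => dist_nonneg)
      ?_ h1)
    filter_upwards [self_mem_nhdsWithin] with s hs
    have := hchord _ (hq t ht).1 _ (hq s hs).1
    rwa [(hq t ht).2, (hq s hs).2] at this
  have hbd : ∀ t ∈ Icc (-T) T, |q t i - x i| ≤ T := fun t ht => by
    have h1 := hchord _ hy _ (hq t ht).1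
    rw [(hq t ht).2] at h1
    have h2 := abs_sub_le (q t i) (y i) (x i)
    have h3 := hxy i
    rw [abs_sub_comm] at h3
    nlinarith [mul_le_mul_of_nonneg_left (hnear t ht) hN]
  have hl : -T ∈ Icc (-T) T := ⟨le_rfl, by linarith⟩
  have hr : T ∈ Icc (-T) T := ⟨by linarith, le_rfl⟩
  obtain ⟨t, ht, h0⟩ := intermediate_value_Icc' (f := fun t => q t i - x i - t)
    (by linarith : -T ≤ T) ((hcont.sub continuousOn_const).sub continuousOn_id)
    (show (0 : ℝ) ∈ Icc _ _ from ⟨by have := abs_le.1 (hbd T hr); simp only; linarith,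
      by have := abs_le.1 (hbd (-T) hl); simp only; linarith⟩)
  refine ⟨t, ht, q t, (hq t ht).1, ?_, (hq t ht).2⟩
  rw [hci t ht]
  simp only at h0
  linarith

/-- The heart of the argument. If `f` expands the cones of `A` and `f⁻¹` those of `B` by a factor
`μ ≥ 1`, and `x`, `y` are at distance at most `R` both before and after applying `f`, then up to an
error of order `1 / μ` the difference of `x` and `y` lies in the coordinate cone containing `B`.
The point `z` is the intersection of a curve through `x` tangent to `A` with the preimage of a
curve through `f y` tangent to `B`. -/
theorem exists_near_point {A B : ConeField} {i j : Fin 2} (hij : i ≠ j) {M N R : ℝ}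
    (hM : 0 ≤ M) (hN : 0 ≤ N) (hMN : M * N < 1) (hR : 0 ≤ R)
    (hA : ∀ P, A.at P ⊆ slopeCone i j M) (hB : ∀ P, B.at P ⊆ slopeCone j i N) :
    ∃ C : ℝ, ∀ (f : Plane ≃ Plane) (mu : ℝ) (x y : Plane), IsC1Diffeo f → 1 ≤ mu →
      RespectsConeFields f mu A B → ‖x - y‖ ≤ R → ‖f x - f y‖ ≤ R →
      ∃ z, z - y ∈ slopeCone j i N ∧ ‖z - x‖ ≤ C / mu := by
  -- `T` solves `R + N * (R + M * T) = T`: half the extent of the curve through `x`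
  set T := R * (1 + N) / (1 - M * N) with hTdef
  have hT : 0 ≤ T := div_nonneg (by positivity) (by linarith)
  have hTR : R + N * (R + M * T) ≤ T := by
    have : T * (1 - M * N) = R * (1 + N) := div_mul_cancel₀ _ (by linarith)
    nlinarith
  -- `f⁻¹` shrinks the extent of the curve through `f y` by a factor of at most `1 + N`
  set L := (1 + N) * (R + M * T) with hLdef
  have hL : 0 ≤ L := by positivity
  refine ⟨(1 + M) ^ 2 * (R + (1 + N) * L), fun f mu x y hf1 hmu hf hxy hfxy => ?_⟩
  have hmu0 : 0 < mu := by linarith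
  obtain ⟨c, c', hc0, hc⟩ := A.exists_tangent_curve hij hM hA x hT
  obtain ⟨σ, σ', hσ0, hσ⟩ := B.exists_tangent_curve hij.symm hN hB (f y) hL
  have hzT : (0 : ℝ) ∈ Icc (-T) T := ⟨by linarith, hT⟩
  have hzL : (0 : ℝ) ∈ Icc (-L) L := ⟨by linarith, hL⟩
  have hcchord : ∀ t ∈ Icc (-T) T, c t - x ∈ slopeCone i j M := fun t ht => by
    rw [← hc0]
    exact sub_mem_slopeCone hij ordConnected_Icc (fun t ht => (hc t ht).1)
      (fun t ht h => by simpa [h] using (hc t ht).2.2) (fun t ht => hA _ (hc t ht).2.1) hzT ht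
  have hσchord : ∀ t ∈ Icc (-L) L, σ t - f y ∈ slopeCone j i N := fun t ht => by
    rw [← hσ0]
    exact sub_mem_slopeCone hij.symm ordConnected_Icc (fun t ht => (hσ t ht).1)
      (fun t ht h => by simpa [h] using (hσ t ht).2.2) (fun t ht => hB _ (hσ t ht).2.1) hzL ht
  -- a curve with constant `k`-th velocity `1` is parametrized by its `k`-th coordinate
  have hparam : ∀ {γ γ' : ℝ → Plane} {k : Fin 2} {W : ℝ}, 0 ≤ W →
      (∀ t ∈ Icc (-W) W, HasDerivAt γ (γ' t) t ∧ γ' t k = 1) →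
      ∀ t ∈ Icc (-W) W, γ t k = γ 0 k + t := by
    intro γ γ' k W hW h t ht
    have := abs_sub_le_of_abs_deriv_le (φ := fun t => γ t k - t) (φ' := fun _ => 0) (K := 0)
      (ψ := fun t => t) (ψ' := fun _ => 1) (ordConnected_Icc (a := -W) (b := W))
      (fun t ht => by
        have h1 := (hasDerivAt_apply (h t ht).1 k).sub (hasDerivAt_id t)
        rw [(h t ht).2, sub_self] at h1
        exact h1)
      (fun t _ => hasDerivAt_id t) (by simp) (by simp) (s := 0) (t := t)
      ⟨by linarith, hW⟩ ht
    rw [zero_mul, abs_nonpos_iff] at this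
    linarith
  have hci : ∀ t ∈ Icc (-T) T, c t i = x i + t := fun t ht => by
    rw [hparam hT (fun t ht => ⟨(hc t ht).1, (hc t ht).2.2⟩) t ht, hc0]
  have hσj : ∀ t ∈ Icc (-L) L, σ t j = f y j + t := fun t ht => by
    rw [hparam hL (fun t ht => ⟨(hσ t ht).1, (hσ t ht).2.2⟩) t ht, hσ0]
  have himg := fun s hs t ht => hf.inverse.image_curve hf1.inverse hmu0 hij.symm hB
    (ordConnected_Icc (a := -L) (b := L)) hσ (s := s) (t := t) hs ht
  obtain ⟨t, ht, Q, ⟨s, hs, rfl⟩, hQi, hQj⟩ := exists_crossing (i := i) (j := j) (M := M) (R := R)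
    (L := R + M * T) (S := (fun s => f.symm (σ s)) '' Icc (-L) L) (x := x) (y := y) (c := c)
    hN hT hTR le_rfl (fun k => (abs_apply_le_norm (x - y) k).trans hxy)
    (fun t ht => (hc t ht).1.continuousAt.continuousWithinAt) hci
    (fun t ht => by
      have h1 : |c t j - x j| ≤ M * |c t i - x i| := hcchord t ht
      have h2 : |c t i - x i| ≤ T := by
        rw [hci t ht, add_sub_cancel_left]
        exact abs_le.2 ht
      exact h1.trans (mul_le_mul_of_nonneg_left h2 hM))
    ⟨0, hzL, by simp [hσ0]⟩
    (by
      rintro _ ⟨s, hs, rfl⟩ _ ⟨t, ht, rfl⟩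
      exact (himg s hs t ht).1)
    (by
      intro r hr
      obtain ⟨s, hs, h⟩ := exists_eq_of_expanding (τ := fun s => f.symm (σ s) j) (T := L)
        (m := 1 / (1 + N)) (y := r) hL (by positivity)
        (fun t ht => (hasDerivAt_apply ((hf1.inverse.differentiable
          (σ t)).hasFDerivAt.comp_hasDerivAt t (hσ t ht).1) j).continuousAt.continuousWithinAt)
        (fun s hs t ht => by
          rw [div_mul_eq_mul_div, one_mul, div_le_iff₀ (by positivity)]
          have := (himg s hs t ht).2
          nlinarith [abs_nonneg (t - s)])
        (by
          rw [hσ0, Equiv.symm_apply_apply, hLdef, ← mul_assoc,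
            one_div_mul_cancel (by positivity), one_mul]
          exact hr)
      exact ⟨_, ⟨s, hs, rfl⟩, h⟩)
  have hz : f.symm (σ s) = c t := by
    ext k
    have hk : k = i ∨ k = j := by
      clear_value T L
      revert hij
      fin_cases i <;> fin_cases j <;> fin_cases k <;> simp
    rcases hk with rfl | rfl
    · exact hQi
    · exact hQj
  have hfz : f (c t) = σ s := by rw [← hz, Equiv.apply_symm_apply]
  refine ⟨c t, ?_, ?_⟩
  · have := (himg 0 hzL s hs).1
    rwa [hz, hσ0, Equiv.symm_apply_apply] at this
  · have h1 : ‖c t - x‖ ≤ (1 + M) * |t| := by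
      have := norm_le_of_mem_slopeCone hij (hcchord t ht)
      rwa [PiLp.sub_apply, hci t ht, add_sub_cancel_left] at this
    have h2 := (hf.image_curve hf1 hmu0 hij hA ordConnected_Icc hc hzT ht).2
    rw [hc0, sub_zero] at h2
    have h3 : |f (c t) i - f x i| ≤ R + (1 + N) * L := by
      have h4 := norm_le_of_mem_slopeCone hij.symm (hσchord s hs)
      rw [PiLp.sub_apply, hσj s hs, add_sub_cancel_left] at h4
      have h5 : |s| ≤ L := abs_le.2 hs
      have h6 := abs_apply_le_norm (f (c t) - f x) i
      have h7 : ‖f (c t) - f x‖ ≤ ‖σ s - f y‖ + ‖f x - f y‖ := by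
        rw [hfz, show σ s - f x = (σ s - f y) - (f x - f y) by abel]
        exact norm_sub_le _ _
      rw [PiLp.sub_apply] at h6
      have h8 := mul_le_mul_of_nonneg_left h5 (by positivity : 0 ≤ 1 + N)
      linarith
    rw [le_div_iff₀ hmu0]
    have h9 := mul_le_mul_of_nonneg_left h3 (by positivity : 0 ≤ 1 + M)
    nlinarith [mul_le_mul_of_nonneg_right h1 hmu0.le,
      mul_le_mul_of_nonneg_left (h2.trans h9) (by positivity : 0 ≤ 1 + M)]

/-! ### Orbits that stay close to each other -/

theorem isClosed_slopeCone (i j : Fin 2) (M : ℝ) : IsClosed (slopeCone i j M) :=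
  isClosed_le (EuclideanSpace.proj (𝕜 := ℝ) j).continuous.abs
    (continuous_const.mul (EuclideanSpace.proj (𝕜 := ℝ) i).continuous.abs)

/-- Two forward orbits of a sequence of diffeomorphisms that stay at a bounded distance differ by a
vector of the coordinate cone of the contracted direction. -/
theorem sub_mem_slopeCone_of_bounded_orbits {A B : ConeField} {i j : Fin 2} (hij : i ≠ j)
    {M N R lam : ℝ} (hM : 0 ≤ M) (hN : 0 ≤ N) (hMN : M * N < 1) (hlam : 1 < lam)
    (hA : ∀ P, A.at P ⊆ slopeCone i j M) (hB : ∀ P, B.at P ⊆ slopeCone j i N)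
    {G : ℕ → Plane ≃ Plane} (hG1 : ∀ n, IsC1Diffeo (G n))
    (hG : ∀ n, RespectsConeFields (G n) lam A B) {x y : ℕ → Plane}
    (hx : ∀ n, x (n + 1) = G n (x n)) (hy : ∀ n, y (n + 1) = G n (y n))
    (hxy : ∀ n, ‖x n - y n‖ ≤ R) : x 0 - y 0 ∈ slopeCone j i N := by
  have hcomp : ∀ n, ∃ f : Plane ≃ Plane, IsC1Diffeo f ∧
      RespectsConeFields f (lam ^ (n + 1)) A B ∧ f (x 0) = x (n + 1) ∧ f (y 0) = y (n + 1) := by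
    intro n
    induction n with
    | zero => exact ⟨G 0, hG1 0, by simpa using hG 0, (hx 0).symm, (hy 0).symm⟩
    | succ n ih =>
      obtain ⟨f, hf1, hf, hfx, hfy⟩ := ih
      refine ⟨f.trans (G (n + 1)), hf1.trans (hG1 _), ?_, ?_, ?_⟩
      · rw [pow_succ' lam (n + 1)]
        exact hf.trans hf1 (hG1 _) (by positivity) (by positivity) (hG _)
      · rw [Equiv.trans_apply, hfx, hx (n + 1)]
      · rw [Equiv.trans_apply, hfy, hy (n + 1)]
  obtain ⟨C, hC⟩ := exists_near_point hij hM hN hMN ((norm_nonneg _).trans (hxy 0)) hA hB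
  have hz : ∀ n, ∃ z, z - y 0 ∈ slopeCone j i N ∧ ‖z - x 0‖ ≤ C / lam ^ (n + 1) := fun n => by
    obtain ⟨f, hf1, hf, hfx, hfy⟩ := hcomp n
    exact hC f _ _ _ hf1 (one_le_pow₀ hlam.le) hf (hxy 0) (by rw [hfx, hfy]; exact hxy (n + 1))
  choose z hzy hzx using hz
  have hpow : Tendsto (fun n : ℕ => C / lam ^ (n + 1)) atTop (𝓝 0) :=
    ((tendsto_pow_atTop_atTop_of_one_lt hlam).comp (tendsto_add_atTop_nat 1)).const_div_atTop C
  have hlim : Tendsto z atTop (𝓝 (x 0)) :=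
    tendsto_iff_norm_sub_tendsto_zero.2 (squeeze_zero (fun _ => norm_nonneg _) hzx hpow)
  exact (isClosed_slopeCone j i N).mem_of_tendsto (hlim.sub_const (y 0)) (Eventually.of_forall hzy)

/-! ### The divider as a graph -/

/-- A curve all of whose chords lie in a vertical cone and which reaches every height is the graph
of a Lipschitz function of the second coordinate. -/
theorem exists_lipschitz_graph {G : Set Plane} {N : ℝ}
    (hchord : ∀ P ∈ G, ∀ Q ∈ G, Q - P ∈ slopeCone 1 0 N) (hheight : ∀ y : ℝ, ∃ P ∈ G, P 1 = y) :
    ∃ g : ℝ → ℝ, (∀ s t, |g s - g t| ≤ N * |s - t|) ∧ ∀ P, P ∈ G ↔ P 0 = g (P 1) := by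
  choose q hqG hq1 using hheight
  have hc : ∀ P ∈ G, ∀ Q ∈ G, |Q 0 - P 0| ≤ N * |Q 1 - P 1| := fun P hP Q hQ => hchord P hP Q hQ
  have huniq : ∀ P ∈ G, ∀ Q ∈ G, Q 1 = P 1 → Q 0 = P 0 := fun P hP Q hQ h => by
    have := hc P hP Q hQ
    rw [h, sub_self, abs_zero, mul_zero, abs_nonpos_iff] at this
    linarith
  refine ⟨fun t => q t 0, fun s t => ?_, fun P => ⟨fun hP => ?_, fun hP => ?_⟩⟩
  · have := hc _ (hqG t) _ (hqG s)
    rwa [hq1, hq1] at this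
  · exact huniq _ (hqG _) _ hP (hq1 _).symm
  · have : P = q (P 1) := by
      ext k
      fin_cases k
      · exact hP
      · exact (hq1 _).symm
    rw [this]
    exact hqG _

theorem mem_leftHalfPlane_iff {G : Set Plane} {g : ℝ → ℝ} (hg : ∀ P, P ∈ G ↔ P 0 = g (P 1))
    {P : Plane} : P ∈ leftHalfPlane G ↔ P 0 ≤ g (P 1) := by
  constructor
  · rintro ⟨Q, hQ, h1, h0⟩
    rwa [(hg Q).1 hQ, h1] at h0
  · intro h
    exact ⟨!₂[g (P 1), P 1], (hg _).2 (by simp), by simp, by simpa using h⟩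

theorem mem_rightHalfPlane_iff {G : Set Plane} {g : ℝ → ℝ} (hg : ∀ P, P ∈ G ↔ P 0 = g (P 1))
    {P : Plane} : P ∈ rightHalfPlane G ↔ g (P 1) ≤ P 0 := by
  constructor
  · rintro ⟨Q, hQ, h1, h0⟩
    rwa [(hg Q).1 hQ, h1] at h0
  · intro h
    exact ⟨!₂[g (P 1), P 1], (hg _).2 (by simp), by simp, by simpa using h⟩

/-! ### Orientation and the sides of the divider -/

/-- The determinant of a linear map of the plane is its effect on the oriented area. -/
theorem det_mul_area (L : Plane →L[ℝ] Plane) (u v : Plane) :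
    L.det * (u 0 * v 1 - u 1 * v 0) = L u 0 * L v 1 - L u 1 * L v 0 := by
  have hdec : ∀ w : Plane, w = w 0 • EuclideanSpace.single 0 1 + w 1 • EuclideanSpace.single 1 1 :=
    fun w => by
      ext k
      fin_cases k <;> simp
  have hdet : L.det = L (EuclideanSpace.single 0 1) 0 * L (EuclideanSpace.single 1 1) 1 -
      L (EuclideanSpace.single 1 1) 0 * L (EuclideanSpace.single 0 1) 1 := by
    rw [ContinuousLinearMap.det, ← LinearMap.det_toMatrix (EuclideanSpace.basisFun (Fin 2) ℝ).toBasis,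
      Matrix.det_fin_two]
    simp [LinearMap.toMatrix_apply]
  have hL : ∀ (w : Plane) (k : Fin 2), L w k =
      w 0 * L (EuclideanSpace.single 0 1) k + w 1 * L (EuclideanSpace.single 1 1) k := fun w k => by
    conv_lhs => rw [hdec w]
    simp
  rw [hdet, hL u, hL u, hL v, hL v]
  ring

theorem eventually_neg_of_hasDerivAt_neg {f : ℝ → ℝ} {d : ℝ} (hf : HasDerivAt f d 0) (h0 : f 0 = 0)
    (hd : d < 0) : ∀ᶠ s in 𝓝[>] (0 : ℝ), f s < 0 := by
  have h1 := (hasDerivAt_iff_tendsto_slope.1 hf).eventually_lt_const hd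
  have h2 : 𝓝[>] (0 : ℝ) ≤ 𝓝[≠] 0 := nhdsWithin_mono _ fun s hs => ne_of_gt hs
  filter_upwards [h2 h1, self_mem_nhdsWithin] with s hs hpos
  rw [slope_def_field, h0, sub_zero, sub_zero, div_neg_iff] at hs
  rcases hs with h | h
  · exact absurd h.2 (not_lt.2 (le_of_lt hpos))
  · exact h.1

/-- An orientation preserving diffeomorphism that fixes a Lipschitz graph pointwise cannot send the
left side to the right side. Since the left side is connected and is mapped off the graph, it is
enough to follow one point approaching the graph horizontally: there the derivative fixes the
tangent vector of the graph and has positive determinant. -/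
theorem left_of_graph_of_fixes {H : Plane ≃ Plane} (hH : Differentiable ℝ H)
    (hdet : ∀ P, 0 < (fderiv ℝ H P).det) {N : ℝ} {g : ℝ → ℝ}
    (hgN : ∀ s t, |g s - g t| ≤ N * |s - t|) {G : Set Plane} (hg : ∀ P, P ∈ G ↔ P 0 = g (P 1))
    {γ : ℝ → Plane} {v : Plane} (hγ : HasDerivAt γ v 0) (hv : v 1 ≠ 0) (hγG : range γ = G)
    (hfix : ∀ t, H (γ t) = γ t) {P : Plane} (hP : P 0 < g (P 1)) : H P 0 < g (H P 1) := by
  have hgc : Continuous g := by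
    refine continuous_iff_continuousAt.2 fun t => ?_
    refine tendsto_iff_dist_tendsto_zero.2 (squeeze_zero (fun _ => dist_nonneg) (fun s => hgN s t) ?_)
    have : Continuous fun s => N * |s - t| := by fun_prop
    simpa using this.tendsto t
  have hc : ∀ k : Fin 2, Continuous fun P : Plane => P k := fun k =>
    (EuclideanSpace.proj (𝕜 := ℝ) k).continuous
  have hHG : ∀ P, H P ∈ G → P ∈ G := fun P h => by
    rw [← hγG] at h ⊢
    obtain ⟨t, ht⟩ := h
    exact ⟨t, H.injective (by rw [hfix, ht])⟩
  set e : Plane := !₂[1, 0] with he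
  -- a point to the left of the graph, close to `γ 0`, stays on the left
  have hnear : ∃ s : ℝ, 0 < s ∧ H (γ 0 - s • e) 0 < g (H (γ 0 - s • e) 1) := by
    set L := fderiv ℝ H (γ 0) with hLdef
    have hLv : L v = v := by
      have h1 : HasDerivAt (fun t => H (γ t)) (L v) 0 :=
        (hH (γ 0)).hasFDerivAt.comp_hasDerivAt 0 hγ
      simp only [hfix] at h1
      exact h1.unique hγ
    have harea := det_mul_area L v (-e)
    rw [hLv] at harea
    simp only [he, PiLp.neg_apply] at harea
    rw [← he] at harea
    simp only [Matrix.cons_val_zero, Matrix.cons_val_one] at harea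
    -- write `L (-e) = a • v - det L • e` and compare with `γ (a * s)` in `G`
    set a := L (-e) 1 / v 1 with ha
    have hav : a * v 1 = L (-e) 1 := div_mul_cancel₀ _ hv
    have hδ : HasDerivAt (fun s : ℝ => H (γ 0 - s • e) - γ (a * s)) (L (-e) - a • v) 0 := by
      have h1 : HasDerivAt (fun s : ℝ => γ 0 - s • e) (-e) 0 := by
        have := ((hasDerivAt_id (0 : ℝ)).smul_const e).const_sub (γ 0)
        simpa using this
      have h2 : HasDerivAt (fun s : ℝ => H (γ 0 - s • e)) (L (-e)) 0 := by
        have h0 : HasFDerivAt H L (γ 0 - (0 : ℝ) • e) := by simpa using (hH (γ 0)).hasFDerivAt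
        exact h0.comp_hasDerivAt 0 h1
      have h3 : HasDerivAt (fun s => γ (a * s)) (a • v) 0 := by
        have h4 : HasDerivAt (fun s : ℝ => a * s) a 0 := by
          simpa using (hasDerivAt_id (0 : ℝ)).const_mul a
        have h0 : HasDerivAt γ v (a * 0) := by simpa using hγ
        exact h0.scomp 0 h4
      exact h2.sub h3
    have hδ0 := hasDerivAt_apply hδ 0
    have hδ1 := hasDerivAt_apply hδ 1
    have hd0 : (L (-e) - a • v) 0 = -L.det := by
      have : v 1 * ((L (-e) - a • v) 0) = v 1 * (-L.det) := by
        simp only [PiLp.sub_apply, PiLp.smul_apply, smul_eq_mul]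
        linear_combination harea - v 0 * hav
      exact mul_left_cancel₀ hv this
    have hd1 : (L (-e) - a • v) 1 = 0 := by
      simp only [PiLp.sub_apply, PiLp.smul_apply, smul_eq_mul]
      linarith
    rw [hd0] at hδ0
    rw [hd1] at hδ1
    have hdL := hdet (γ 0)
    have hm := eventually_neg_of_hasDerivAt_neg (hδ0.add (hδ1.const_mul N))
      (by simp [hfix]) (by simpa using hdL)
    have hp := eventually_neg_of_hasDerivAt_neg (hδ0.sub (hδ1.const_mul N))
      (by simp [hfix]) (by simpa using hdL)
    obtain ⟨s, ⟨hs1, hs2⟩, hs⟩ := ((hm.and hp).and self_mem_nhdsWithin).exists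
    refine ⟨s, hs, ?_⟩
    simp only [Pi.add_apply, Pi.sub_apply, PiLp.sub_apply] at hs1 hs2
    have h1 := (hg _).1 (hγG ▸ mem_range_self (a * s) : γ (a * s) ∈ G)
    have h2 := (abs_le.1 (hgN (H (γ 0 - s • e) 1) (γ (a * s) 1))).1
    rcases abs_cases (H (γ 0 - s • e) 1 - γ (a * s) 1) with h3 | h3 <;> rw [h3.1] at h2 <;> linarith
  obtain ⟨s, hs, hsH⟩ := hnear
  have hconn : IsPreconnected {P : Plane | P 0 < g (P 1)} := by
    have h1 : IsPreconnected ((fun q : ℝ × ℝ => (!₂[g q.2 + q.1, q.2] : Plane)) ''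
        (Iio (0 : ℝ) ×ˢ univ)) := by
      refine (isPreconnected_Iio.prod isPreconnected_univ).image _ (Continuous.continuousOn ?_)
      refine (PiLp.continuous_toLp 2 _).comp (continuous_pi fun k => ?_)
      fin_cases k
      · exact (hgc.comp continuous_snd).add continuous_fst
      · exact continuous_snd
    convert h1
    ext Q
    simp only [mem_ofPred_eq, mem_image, mem_prod, mem_Iio, mem_univ, and_true, Prod.exists]
    constructor
    · intro h
      refine ⟨Q 0 - g (Q 1), Q 1, by linarith, ?_⟩
      ext k
      fin_cases k <;> simp
    · rintro ⟨b, y, hb, rfl⟩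
      simpa using hb
  by_contra! hcon
  have hγ0 : γ 0 0 = g (γ 0 1) := (hg _).1 (hγG ▸ mem_range_self 0)
  have hψ : Continuous fun P : Plane => H P 0 - g (H P 1) :=
    ((hc 0).comp hH.continuous).sub (hgc.comp ((hc 1).comp hH.continuous))
  obtain ⟨Q, hQ, hQ0⟩ := hconn.intermediate_value (a := γ 0 - s • e) (b := P)
    (by simpa [he, hγ0] using hs) hP hψ.continuousOn
    (show (0 : ℝ) ∈ Icc _ _ from ⟨by simp only; linarith, by simp only; linarith⟩)
  have hQ' : Q 0 < g (Q 1) := hQ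
  have := (hg Q).1 (hHG Q ((hg _).2 (by simp only at hQ0; linarith)))
  linarith

/-! ### Injectivity of the glued map -/

theorem det_fderiv_trans_symm_pos {F₁ F₂ : Plane ≃ Plane} (h1 : IsC1Diffeo F₁) (h2 : IsC1Diffeo F₂)
    (hd1 : ∀ P, (fderiv ℝ F₁ P).det < 0) (hd2 : ∀ P, (fderiv ℝ F₂ P).det < 0) (P : Plane) :
    0 < (fderiv ℝ (F₁.trans F₂.symm) P).det := by
  have hcomp : (fderiv ℝ F₂ (F₁.trans F₂.symm P)).det * (fderiv ℝ (F₁.trans F₂.symm) P).det =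
      (fderiv ℝ F₁ P).det := by
    have h : fderiv ℝ F₁ P =
        (fderiv ℝ F₂ (F₁.trans F₂.symm P)).comp (fderiv ℝ (F₁.trans F₂.symm) P) := by
      ext1 u
      rw [ContinuousLinearMap.comp_apply, ← fderiv_trans (h1.trans h2.inverse) h2]
      congr 3
      ext1 Q
      simp
    rw [h]
    exact (LinearMap.det_comp _ _).symm
  have := hd1 P
  have := hd2 (F₁.trans F₂.symm P)
  by_contra! hc
  nlinarith

theorem glue_of_mem_leftHalfPlane {F₁ F₂ : Plane ≃ Plane} {G : Set Plane} {P : Plane}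
    (h : P ∈ leftHalfPlane G) : glue F₁ F₂ G P = F₁ P := if_pos h

theorem glue_of_notMem_leftHalfPlane {F₁ F₂ : Plane ≃ Plane} {G : Set Plane} {P : Plane}
    (h : P ∉ leftHalfPlane G) : glue F₁ F₂ G P = F₂ P := if_neg h

/-- The two maps send the left side of the divider onto the same set, because `F₂⁻¹ ∘ F₁` fixes
the divider and preserves the orientation. -/
theorem glue_injective {F₁ F₂ : Plane ≃ Plane} (h1 : IsC1Diffeo F₁) (h2 : IsC1Diffeo F₂)
    (hd1 : ∀ P, (fderiv ℝ F₁ P).det < 0) (hd2 : ∀ P, (fderiv ℝ F₂ P).det < 0) {N : ℝ} {g : ℝ → ℝ}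
    (hgN : ∀ s t, |g s - g t| ≤ N * |s - t|) {G : Set Plane} (hg : ∀ P, P ∈ G ↔ P 0 = g (P 1))
    {γ : ℝ → Plane} {v : Plane} (hγ : HasDerivAt γ v 0) (hv : v 1 ≠ 0) (hγG : range γ = G)
    (heq : ∀ t, F₁ (γ t) = F₂ (γ t)) : Function.Injective (glue F₁ F₂ G) := by
  have hfix : ∀ t, F₁.trans F₂.symm (γ t) = γ t := fun t => by simp [heq]
  have hmixed : ∀ A B, A ∈ leftHalfPlane G → B ∉ leftHalfPlane G → F₁ A ≠ F₂ B := by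
    intro A B hA hB hAB
    have hH : F₁.trans F₂.symm A = B := by simp [hAB]
    rw [mem_leftHalfPlane_iff hg] at hA hB
    rcases hA.lt_or_eq with hlt | h
    · have := left_of_graph_of_fixes (h1.trans h2.inverse).differentiable
        (det_fderiv_trans_symm_pos h1 h2 hd1 hd2) hgN hg hγ hv hγG hfix hlt
      rw [hH] at this
      exact hB this.le
    · obtain ⟨t, rfl⟩ := hγG.symm ▸ (hg A).2 h
      rw [hfix] at hH
      exact hB (hH ▸ h.le)
  intro A B hAB
  by_cases hA : A ∈ leftHalfPlane G <;> by_cases hB : B ∈ leftHalfPlane G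
  · rw [glue_of_mem_leftHalfPlane hA, glue_of_mem_leftHalfPlane hB] at hAB
    exact F₁.injective hAB
  · rw [glue_of_mem_leftHalfPlane hA, glue_of_notMem_leftHalfPlane hB] at hAB
    exact absurd hAB (hmixed A B hA hB)
  · rw [glue_of_notMem_leftHalfPlane hA, glue_of_mem_leftHalfPlane hB] at hAB
    exact absurd hAB.symm (hmixed B A hB hA)
  · rw [glue_of_notMem_leftHalfPlane hA, glue_of_notMem_leftHalfPlane hB] at hAB
    exact F₂.injective hAB

/-! ### Itineraries and the attractor -/

/-- The diffeomorphism that gives the glued map on the half-plane with the given symbol. -/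
def branch (F₁ F₂ : Plane ≃ Plane) : Sgn → Plane ≃ Plane
  | Sgn.minus => F₁
  | Sgn.plus => F₂

theorem glue_eq_branch {F₁ F₂ : Plane ≃ Plane} {g : ℝ → ℝ} {G : Set Plane}
    (hg : ∀ P, P ∈ G ↔ P 0 = g (P 1)) (heq : ∀ P ∈ G, F₁ P = F₂ P) {s : Sgn} {P : Plane}
    (hP : P ∈ halfPlane G s) : glue F₁ F₂ G P = branch F₁ F₂ s P := by
  cases s with
  | minus => exact glue_of_mem_leftHalfPlane hP
  | plus =>
    by_cases h : P ∈ leftHalfPlane G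
    · rw [glue_of_mem_leftHalfPlane h]
      exact heq P ((hg P).2 (le_antisymm ((mem_leftHalfPlane_iff hg).1 h)
        ((mem_rightHalfPlane_iff hg).1 hP)))
    · exact glue_of_notMem_leftHalfPlane h

theorem orbit_mem_of_mem_attractor {F : Plane → Plane} (hF : Function.Injective F) {D : Set Plane}
    (hD : IsTrappingRegion F D) {x : ℤ → Plane} (hx : ∀ n, x (n + 1) = F (x n))
    (h0 : x 0 ∈ attractor F D) (n : ℤ) : x n ∈ D := by
  have hmaps : ∀ P ∈ D, F P ∈ D := fun P hP =>
    interior_subset (hD.2 (mem_image_of_mem F (subset_closure hP)))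
  have hiter : ∀ (k : ℕ) (m : ℤ), x (m + k) = F^[k] (x m) := fun k m => by
    induction k with
    | zero => simp
    | succ k ih => rw [Function.iterate_succ_apply', ← ih, ← hx, Nat.cast_succ, add_assoc]
  have hmem : ∀ k : ℕ, x 0 ∈ F^[k] '' D := mem_iInter.1 h0
  obtain ⟨k, rfl | rfl⟩ := n.eq_nat_or_neg
  · have hx0 : x 0 ∈ D := by simpa using hmem 0
    have := hiter k 0
    rw [zero_add] at this
    rw [this]
    exact (show MapsTo F D D from hmaps).iterate k hx0
  · obtain ⟨d, hd, h⟩ := hmem k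
    have := hiter k (-k)
    rw [neg_add_cancel, ← h] at this
    exact hF.iterate k this ▸ hd

end LoziLike

open LoziLike Set in
theorem mainTheorem5 (F₁ F₂ : LoziLike.Plane ≃ LoziLike.Plane) (G D : Set LoziLike.Plane)
    (hF : LoziLike.IsLoziLike F₁ F₂ G D)
    (p : ℤ → LoziLike.Sgn)
    (hp : LoziLike.IsAdmissible (LoziLike.glue F₁ F₂ G) G D p) :
    ∃! P : LoziLike.Plane,
      P ∈ LoziLike.attractor (LoziLike.glue F₁ F₂ G) D ∧
      LoziLike.IsItinerary (LoziLike.glue F₁ F₂ G) G P p := by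
  obtain ⟨h1, h2, -, lam, Ku, Ks, Cu, Cs, hlam, ⟨⟨lu, hlu, rfl⟩, ⟨ls, hls, rfl⟩, hK⟩, hCu, hCs,
    hr1, hr2, γ, hγ, hγne, hγG, hγeq, hγs, -, -, hγheight⟩ := hF.synchronouslyHyperbolic
  obtain ⟨M, hM, hMu⟩ := exists_horizontalCone_eq hlu
  obtain ⟨N, hN, hNs⟩ := exists_verticalCone_eq hls
  rw [hMu, hNs] at hK
  rw [hMu] at hCu
  rw [hNs] at hCs
  have hMN := mul_lt_one_of_slopeCone_inter hM hK
  have hγd : ∀ t, HasDerivAt γ (deriv γ t) t := fun t =>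
    (hγ.differentiable (by simp) t).hasDerivAt
  obtain ⟨g, hgN, hg⟩ := exists_lipschitz_graph (G := G) (N := N)
    (by
      rw [← hγG]
      rintro _ ⟨s, rfl⟩ _ ⟨t, rfl⟩
      exact sub_mem_slopeCone (by decide) ordConnected_univ (fun t _ => hγd t)
        (fun t _ => hγne t) (fun t _ => hCs _ (hγs t)) (mem_univ s) (mem_univ t))
    (fun y => by
      obtain ⟨t, ht⟩ := hγheight y
      exact ⟨γ t, hγG ▸ mem_range_self t, ht⟩)
  have hinj : Function.Injective (glue F₁ F₂ G) :=
    glue_injective h1 h2 (fun P => (hF.det_left P).2) (fun P => (hF.det_right P).2) hgN hg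
      (hγd 0) (apply_ne_zero_of_mem_slopeCone (by decide) (hCs _ (hγs 0)) (hγne 0)) hγG hγeq
  have hFG : ∀ P ∈ G, F₁ P = F₂ P := by
    rw [← hγG]
    rintro _ ⟨t, rfl⟩
    exact hγeq t
  have hb1 : ∀ s, IsC1Diffeo (branch F₁ F₂ s) := by rintro (_ | _) <;> assumption
  have hb : ∀ s, RespectsConeFields (branch F₁ F₂ s) lam Cu Cs := by rintro (_ | _) <;> assumption
  have hbounded : Bornology.IsBounded (closure D) := by
    obtain ⟨e⟩ := hF.closure_homeo_disk
    have : CompactSpace (closure D) :=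
      have := isCompact_iff_compactSpace.1 (isCompact_closedBall (0 : Plane) 1)
      e.symm.compactSpace
    exact (isCompact_iff_compactSpace.2 this).isBounded
  obtain ⟨R, hR⟩ := Metric.isBounded_iff.1 hbounded
  obtain ⟨Q, hQ, hQp⟩ := hp
  refine ⟨Q, ⟨hQ, hQp⟩, ?_⟩
  rintro P ⟨hP, x, rfl, hx, hxp⟩
  obtain ⟨y, rfl, hy, hyp⟩ := hQp
  have hxy : ∀ n, ‖x n - y n‖ ≤ R := fun n => by
    rw [← dist_eq_norm]
    exact hR (subset_closure (orbit_mem_of_mem_attractor hinj hF.trapping hx hP n))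
      (subset_closure (orbit_mem_of_mem_attractor hinj hF.trapping hy hQ n))
  have hxb : ∀ n, x (n + 1) = branch F₁ F₂ (p n) (x n) := fun n =>
    (hx n).trans (glue_eq_branch hg hFG (hxp n))
  have hyb : ∀ n, y (n + 1) = branch F₁ F₂ (p n) (y n) := fun n =>
    (hy n).trans (glue_eq_branch hg hFG (hyp n))
  have hfwd : x 0 - y 0 ∈ slopeCone 1 0 N :=
    sub_mem_slopeCone_of_bounded_orbits (i := 0) (j := 1) (by decide) hM hN hMN hlam hCu hCs
      (G := fun n => branch F₁ F₂ (p n)) (x := fun n => x n) (y := fun n => y n)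
      (fun n => hb1 _) (fun n => hb _) (fun n => by push_cast; exact hxb n)
      (fun n => by push_cast; exact hyb n) (fun n => hxy n)
  -- in backward time the roles of the two cone fields are exchanged
  have hback : ∀ z : ℤ → Plane, (∀ n, z (n + 1) = branch F₁ F₂ (p n) (z n)) → ∀ n : ℕ,
      z (-((n + 1 : ℕ) : ℤ)) = (branch F₁ F₂ (p (-((n + 1 : ℕ) : ℤ)))).symm (z (-(n : ℤ))) := by
    intro z hz n
    rw [Equiv.eq_symm_apply, ← hz]
    congr 1
    push_cast
    ring
  have hbwd : x 0 - y 0 ∈ slopeCone 0 1 M :=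
    sub_mem_slopeCone_of_bounded_orbits (i := 1) (j := 0) (by decide) hN hM (by linarith) hlam
      hCs hCu (G := fun n => (branch F₁ F₂ (p (-((n + 1 : ℕ) : ℤ)))).symm)
      (x := fun n => x (-(n : ℤ))) (y := fun n => y (-(n : ℤ)))
      (fun n => (hb1 _).inverse) (fun n => (hb _).inverse) (hback x hxb) (hback y hyb)
      (fun n => hxy _)
  have : x 0 - y 0 ∈ slopeCone 0 1 M ∩ slopeCone 1 0 N := ⟨hbwd, hfwd⟩
  rw [hK, mem_singleton_iff] at this
  exact sub_eq_zero.1 this
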